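/- Let $c\ge 1$, let $\alpha_1,\dots,\alpha_c>0$ be constants, and let $x=(x_1,\dots,x_c)\neq 0$ with all $x_i\ge 0$. Let $\mathbf X(t)=(X_1(t),\dots,X_c(t))$, $t\ge 0$, be the continuum Pólya-like random walk with starting point $\mathbf X(0)=x$ and diagonal navigation matrix $\mathrm{diag}(\alpha_1,\dots,\alpha_c)$ (the component-wise constant Pólya–Eggenberger-like walk). That is, $\mathbf X$ is the piecewise constant jump process such that, given the history up to a renewal after which the position is $S$, the waiting time until the next renewal is exponential with rate $\sum_j S_j$; independently of this waiting time, the next renewal has type $i$ with probability $S_i/\sum_j S_j$; and a renewal of type $i$ adds $\alpha_i$ to the $i$th coordinate and leaves the other coordinates unchanged. Then the following hold. 1. For every $i$, every $t\ge 0$ and every real $u$ with $1-e^{\alpha_i t}(1-e^{-\alpha_i u})>0$, the variable $e^{uX_i(t)}$ is integrable and $$\mathbb E\big[e^{uX_i(t)}\big]=\bigl(1-e^{\alpha_i t}(1-e^{-\alpha_i u})\bigr)^{-x_i/\alpha_i}.$$ 2. For every $i$ and every real $s$ with $\alpha_i s<1$, $$\lim_{t\to\infty}\mathbb E\Bigl[\exp\Bigl(\frac{sX_i(t)}{e^{\alpha_i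 t}}\Bigr)\Bigr]=(1-\alpha_i s)^{-x_i/\alpha_i}.$$ 3. For every $i$, as $t\to\infty$, $X_i(t)/e^{\alpha_i t}$ converges in distribution to the gamma distribution with shape $x_i/\alpha_i$ and scale $\alpha_i$ (the point mass at $0$ if $x_i=0$). 4. As $t\to\infty$, the random vector $\bigl(X_1(t)/e^{\alpha_1 t},\dots,X_c(t)/e^{\alpha_c t}\bigr)$ converges in distribution to a random vector with independent coordinates, whose $i$th coordinate has the gamma distribution in 3; that is, the limit law is the product of these distributions. -/

import Mathlib

open MeasureTheory ProbabilityTheory Filter Topology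
open scoped NNReal

noncomputable section

/-- Position of the walk after `n` renewals: it starts at `x`, and a renewal of type `i` adds row `i`
of the navigation matrix `A`. Here `I k` is the type of the `k`-th renewal (counting from `0`). -/
def polyaPosition {Ω : Type*} {c : ℕ} (A : Matrix (Fin c) (Fin c) ℝ) (x : Fin c → ℝ)
    (I : ℕ → Ω → Fin c) (n : ℕ) (ω : Ω) : Fin c → ℝ :=
  x + ∑ k ∈ Finset.range n, A.row (I k ω)

/-- Time of the `n`-th renewal, where `W k` is the `k`-th waiting time; the zeroth one is time `0`. -/
def renewalEpoch {Ω : Type*} (W : ℕ → Ω → ℝ) (n : ℕ) (ω : Ω) : ℝ :=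
  ∑ k ∈ Finset.range n, W k ω

/-- The σ-algebra generated by the first `n` waiting times and the first `n` renewal types. -/
abbrev renewalHistory {Ω : Type*} {c : ℕ} (W : ℕ → Ω → ℝ) (I : ℕ → Ω → Fin c) (n : ℕ) :
    MeasurableSpace Ω :=
  MeasurableSpace.comap (fun ω (k : Fin n) => (W k ω, I k ω)) inferInstance

/-- `W` (waiting times) and `I` (renewal types) drive the process `X` as a continuum Pólya-like walk
with navigation matrix `A` and starting point `x`. Given the history of the first `n` renewals, with
`S` the current position and `|S| = ∑ j, S j`, the next waiting time is exponential with rate `|S|`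
and, independently of it, the next renewal has type `i` with probability `S i / |S|`. The process
stays at the current position until the next renewal. -/
structure IsDrivenBy {Ω : Type*} [MeasurableSpace Ω] {c : ℕ} (P : Measure Ω)
    (A : Matrix (Fin c) (Fin c) ℝ) (x : Fin c → ℝ) (X : ℝ≥0 → Ω → Fin c → ℝ)
    (W : ℕ → Ω → ℝ) (I : ℕ → Ω → Fin c) : Prop where
  measurable_wait : ∀ n, Measurable (W n)
  measurable_type : ∀ n, Measurable (I n)
  condProb_renewal : ∀ (n : ℕ) (i : Fin c) (w : ℝ), 0 ≤ w →
    P⟦{ω | w < W n ω ∧ I n ω = i} | renewalHistory W I n⟧ =ᵐ[P]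
      fun ω => Real.exp (-(w * ∑ j, polyaPosition A x I n ω j)) *
        (polyaPosition A x I n ω i / ∑ j, polyaPosition A x I n ω j)
  path_eq : ∀ᵐ ω ∂P, ∀ (n : ℕ) (t : ℝ≥0),
    renewalEpoch W n ω ≤ t → (t : ℝ) < renewalEpoch W (n + 1) ω →
      X t ω = polyaPosition A x I n ω

/-- `X` is, under `P`, a continuum Pólya-like random walk with (deterministic) navigation matrix `A`
and starting point `x`. (For a tenable pair `A`, `x`, that is, one for which the walk keeps
nonnegative coordinates and avoids the origin.) -/
def IsContinuumPolyaWalk {Ω : Type*} [MeasurableSpace Ω] {c : ℕ} (P : Measure Ω)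
    (A : Matrix (Fin c) (Fin c) ℝ) (x : Fin c → ℝ) (X : ℝ≥0 → Ω → Fin c → ℝ) : Prop :=
  ∃ (W : ℕ → Ω → ℝ) (I : ℕ → Ω → Fin c), IsDrivenBy P A x X W I

open Classical in
/-- The gamma distribution with shape `k` and scale `θ`, whose moment generating function is
`s ↦ (1 - θ * s) ^ (-k)` for `θ * s < 1`. Mathlib's `gammaMeasure` takes the shape and the rate.
Shape `0` is the degenerate case of the point mass at `0`. -/
def gammaLaw (k θ : ℝ) : Measure ℝ :=
  if 0 < k ∧ 0 < θ then gammaMeasure k θ⁻¹ else Measure.dirac 0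

instance gammaLaw_isProbabilityMeasure (k θ : ℝ) : IsProbabilityMeasure (gammaLaw k θ) := by
  unfold gammaLaw
  split_ifs with h
  · exact isProbabilityMeasure_gammaMeasure h.1 (inv_pos.mpr h.2)
  · infer_instance

end

/-! Write b_i(τ) for the base 1 - e^{α_i τ}(1 - e^{-α_i u_i}) and M(τ, y) for the product of the
powers b_i(τ)^(-y_i/α_i). Since b_i' = α_i (b_i - 1), and adding α_i to y_i divides M by b_i, M
solves the backward equation ∂M/∂τ = ∑ y_i (M(τ, y + α_i e_i) - M(τ, y)) with M(0, y) = e^{u·y}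
(`hasDerivAt_jointMgf`). Integrating it against the exponential waiting time gives the first-renewal
equation (`jointMgf_eq_first_renewal`).

Iterating along the renewal times T_n and positions S_n, M(t, x) is the contribution to
E[e^{u·X(t)}] of paths with fewer than n renewals by time t, plus the remainder E[M(t - T_n, S_n);
T_n ≤ t] (`lintegral_jointMgf_renewal`). The remainder vanishes geometrically: a slightly larger u'
is still admissible, its own remainders stay bounded, and M for u is at most ρ^n times M for u' at
S_n, with ρ < 1 (`tendsto_lintegral_jointMgf_renewal`). The case u = 0, where M = 1, is
non-explosion; the general case identifies M as the joint moment generating function.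

Taking u_i = s_i e^{-α_i t}, the bases tend to 1 - α_i s_i. As M is a product, the joint Laplace
transforms converge to a product of gamma transforms; Chernoff bounds give tightness, and
`tendsto_of_tendsto_laplace` gives joint convergence. The coordinatewise limits are its marginals.
-/

/-- The base `1 - e^{aτ} (1 - e^{-au})` of the moment generating function, at `u`, of a coordinate
with increment `a` after time `τ`. -/
noncomputable def mgfBase (a u τ : ℝ) : ℝ :=
  1 - Real.exp (a * τ) * (1 - Real.exp (-(a * u)))

/-- The joint moment generating function, at `u`, of the walk with increments `α` that started at
`y` a time `τ` ago. -/
noncomputable def jointMgf {ι : Type*} [Fintype ι] (α u : ι → ℝ) (τ : ℝ) (y : ι → ℝ) : ℝ :=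
  ∏ i, mgfBase (α i) (u i) τ ^ (-(y i / α i))

/-! ### The candidate generating function and its backward equation -/

lemma mgfBase_zero_right (a u : ℝ) : mgfBase a u 0 = Real.exp (-(a * u)) := by
  simp [mgfBase]

lemma mgfBase_zero_left (a τ : ℝ) : mgfBase a 0 τ = 1 := by
  simp [mgfBase]

/-- As a function of time the base is either at least 1 throughout or nonincreasing. Admissibility
of `u` at the final time therefore passes to every remaining time after a renewal. -/
lemma mgfBase_pos_of_le {a u σ τ : ℝ} (ha : 0 < a) (hστ : σ ≤ τ) (h : 0 < mgfBase a u τ) :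
    0 < mgfBase a u σ := by
  unfold mgfBase at *
  rcases le_total (1 - Real.exp (-(a * u))) 0 with h0 | h0
  · nlinarith [mul_nonneg (Real.exp_pos (a * σ)).le (neg_nonneg.2 h0)]
  · have : Real.exp (a * σ) ≤ Real.exp (a * τ) := by gcongr
    nlinarith [mul_le_mul_of_nonneg_right this h0]

lemma mgfBase_pos_of_nonpos {a u τ : ℝ} (ha : 0 < a) (hu : u ≤ 0) : 0 < mgfBase a u τ := by
  have : 1 ≤ Real.exp (-(a * u)) := Real.one_le_exp (by nlinarith)
  unfold mgfBase
  nlinarith [mul_nonneg (Real.exp_pos (a * τ)).le (sub_nonneg.2 this)]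

lemma hasDerivAt_mgfBase (a u τ : ℝ) :
    HasDerivAt (mgfBase a u) (-(a * (1 - mgfBase a u τ))) τ := by
  unfold mgfBase
  have h : HasDerivAt (fun τ => a * τ) a τ := by simpa using (hasDerivAt_id τ).const_mul a
  exact ((h.exp.mul_const (1 - Real.exp (-(a * u)))).const_sub 1).congr_deriv (by ring)

@[fun_prop]
lemma continuous_mgfBase (a u : ℝ) : Continuous (mgfBase a u) := by
  unfold mgfBase; fun_prop

section jointMgf

variable {ι : Type*} [Fintype ι] {α u : ι → ℝ}

lemma jointMgf_zero_time (hα : ∀ i, 0 < α i) (y : ι → ℝ) :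
    jointMgf α u 0 y = Real.exp (∑ i, u i * y i) := by
  rw [jointMgf, Real.exp_sum]
  refine Finset.prod_congr rfl fun i _ => ?_
  rw [mgfBase_zero_right, ← Real.exp_mul]
  have := (hα i).ne'
  congr 1
  field_simp

lemma jointMgf_zero (τ : ℝ) (y : ι → ℝ) : jointMgf α 0 τ y = 1 := by
  simp [jointMgf, mgfBase_zero_left]

lemma jointMgf_pos {τ : ℝ} (h : ∀ i, 0 < mgfBase (α i) (u i) τ) (y : ι → ℝ) :
    0 < jointMgf α u τ y :=
  Finset.prod_pos fun i _ => Real.rpow_pos_of_pos (h i) _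

lemma jointMgf_add_single [DecidableEq ι] {τ : ℝ} (hα : ∀ i, 0 < α i)
    (h : ∀ i, 0 < mgfBase (α i) (u i) τ) (y : ι → ℝ) (i : ι) :
    jointMgf α u τ (y + Pi.single i (α i)) = jointMgf α u τ y / mgfBase (α i) (u i) τ := by
  unfold jointMgf
  rw [← Finset.mul_prod_erase _ _ (Finset.mem_univ i),
    ← Finset.mul_prod_erase Finset.univ (fun i => mgfBase (α i) (u i) τ ^ (-(y i / α i)))
      (Finset.mem_univ i), mul_div_right_comm]
  congr 1
  · rw [← Real.rpow_sub_one (h i).ne']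
    have := (hα i).ne'
    congr 1
    simp only [Pi.add_apply, Pi.single_eq_same]
    field_simp
    ring
  · refine Finset.prod_congr rfl fun k hk => ?_
    simp [Pi.single_eq_of_ne (Finset.ne_of_mem_erase hk)]

/-- Kolmogorov's backward equation. With b' = a(b - 1), the logarithmic derivative of b^(-y/a) is
y(1/b - 1), and the factor 1/b is exactly the effect of one renewal on the product. -/
lemma hasDerivAt_jointMgf [DecidableEq ι] {τ : ℝ} (hα : ∀ i, 0 < α i)
    (h : ∀ i, 0 < mgfBase (α i) (u i) τ) (y : ι → ℝ) :
    HasDerivAt (fun τ => jointMgf α u τ y)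
      (∑ i, y i * jointMgf α u τ (y + Pi.single i (α i)) - (∑ i, y i) * jointMgf α u τ y) τ := by
  unfold jointMgf
  have h1 := HasDerivAt.fun_finsetProd (u := Finset.univ)
    (f := fun i τ => mgfBase (α i) (u i) τ ^ (-(y i / α i)))
    fun i _ => (hasDerivAt_mgfBase (α i) (u i) τ).rpow_const (p := -(y i / α i))
      (Or.inl (h i).ne')
  refine h1.congr_deriv ?_
  rw [Finset.sum_mul, ← Finset.sum_sub_distrib]
  refine Finset.sum_congr rfl fun i _ => ?_
  have h2 := jointMgf_add_single hα h y i
  simp only [jointMgf] at h2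
  rw [h2, ← Finset.mul_prod_erase _ _ (Finset.mem_univ i), smul_eq_mul,
    Real.rpow_sub_one (h i).ne']
  have := (hα i).ne'
  have := (h i).ne'
  field_simp

@[fun_prop]
lemma measurable_jointMgf (y : ι → ℝ) : Measurable fun τ => jointMgf α u τ y := by
  unfold jointMgf
  fun_prop

lemma continuousOn_jointMgf (hα : ∀ i, 0 < α i) {τ : ℝ}
    (h : ∀ i, 0 < mgfBase (α i) (u i) τ) (y : ι → ℝ) :
    ContinuousOn (fun σ => jointMgf α u σ y) (Set.Iic τ) := by
  unfold jointMgf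
  refine continuousOn_finsetProd _ fun i _ => ?_
  exact (continuous_mgfBase _ _).continuousOn.rpow_const
    fun σ hσ => Or.inl (mgfBase_pos_of_le (hα i) hσ (h i)).ne'

end jointMgf

/-! ### Exponential waiting times and the first-renewal equation -/

lemma expMeasure_Ioi {r : ℝ} (hr : 0 < r) (w : ℝ) :
    expMeasure r (Set.Ioi w) = ENNReal.ofReal (Real.exp (-(r * max w 0))) := by
  have := isProbabilityMeasure_expMeasure hr
  rw [← Set.compl_Iic, prob_compl_eq_one_sub measurableSet_Iic,
    ← ofReal_cdf, cdf_expMeasure_eq hr, ← ENNReal.ofReal_one, ← ENNReal.ofReal_sub]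
  · split_ifs with h
    · simp [max_eq_left h]
    · simp [max_eq_right (not_le.1 h).le]
  · split_ifs with h
    · simpa using mul_nonneg hr.le h
    · rfl

lemma ae_expMeasure_pos {r : ℝ} (hr : 0 < r) : ∀ᵐ w ∂expMeasure r, 0 < w := by
  have := isProbabilityMeasure_expMeasure hr
  have h := expMeasure_Ioi hr 0
  simp only [max_self, mul_zero, neg_zero, Real.exp_zero, ENNReal.ofReal_one] at h
  exact (prob_compl_eq_zero_iff measurableSet_Ioi).2 h

lemma setLIntegral_Iic_expMeasure {r τ : ℝ} (f : ℝ → ENNReal) :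
    ∫⁻ w in Set.Iic τ, f w ∂expMeasure r =
      ∫⁻ w in Set.Ioc 0 τ, ENNReal.ofReal (r * Real.exp (-(r * w))) * f w := by
  have h : expMeasure r = (volume.restrict (Set.Ioi 0)).withDensity
      fun w => ENNReal.ofReal (r * Real.exp (-(r * w))) := by
    rw [Measure.restrict_congr_set Ioi_ae_eq_Ici, ← withDensity_indicator measurableSet_Ici]
    change volume.withDensity (exponentialPDF r) = _
    congr 1
    ext w
    rw [exponentialPDF_eq]
    by_cases hw : 0 ≤ w <;> simp [hw, Set.indicator]
  rw [h, restrict_withDensity measurableSet_Iic,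
    lintegral_withDensity_eq_lintegral_mul_non_measurable _ (by fun_prop) (by simp),
    Measure.restrict_restrict measurableSet_Iic, Set.Iic_inter_Ioi]
  rfl

/-- Decomposition of the joint moment generating function according to the first renewal. -/
lemma jointMgf_eq_first_renewal {ι : Type*} [Fintype ι] [DecidableEq ι] {α u y : ι → ℝ} {τ : ℝ}
    (hα : ∀ i, 0 < α i) (hτ : 0 ≤ τ) (h : ∀ i, 0 < mgfBase (α i) (u i) τ)
    (hy : ∀ i, 0 ≤ y i) (hy' : 0 < ∑ i, y i) :
    ∑ i, ENNReal.ofReal (y i / ∑ j, y j) *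
        (ENNReal.ofReal (Real.exp (∑ i, u i * y i)) * expMeasure (∑ j, y j) (Set.Ioi τ) +
          ∫⁻ w in Set.Iic τ, ENNReal.ofReal (jointMgf α u (τ - w) (y + Pi.single i (α i)))
            ∂expMeasure (∑ j, y j)) =
      ENNReal.ofReal (jointMgf α u τ y) := by
  set r := ∑ j, y j with hr
  have hpos : ∀ σ ≤ τ, ∀ i, 0 < mgfBase (α i) (u i) σ :=
    fun σ hσ i => mgfBase_pos_of_le (hα i) hσ (h i)
  have hp : ∀ i, 0 ≤ y i / r := fun i => div_nonneg (hy i) hy'.le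
  have hsum : ∑ i, ENNReal.ofReal (y i / r) = 1 := by
    rw [← ENNReal.ofReal_sum_of_nonneg fun i _ => hp i, ← Finset.sum_div, ← hr,
      div_self hy'.ne', ENNReal.ofReal_one]
  have hcont : ∀ z : ι → ℝ, ContinuousOn (fun w => jointMgf α u (τ - w) z) (Set.Icc 0 τ) :=
    fun z => (continuousOn_jointMgf hα h z).comp (by fun_prop) fun w hw => by
      simpa using hw.1
  have hI : ∀ i, ∫⁻ w in Set.Iic τ, ENNReal.ofReal (jointMgf α u (τ - w) (y + Pi.single i (α i)))
        ∂expMeasure r = ENNReal.ofReal (∫ w in (0 : ℝ)..τ, r * Real.exp (-(r * w)) *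
          jointMgf α u (τ - w) (y + Pi.single i (α i))) := by
    intro i
    rw [setLIntegral_Iic_expMeasure, intervalIntegral.integral_of_le hτ,
      ofReal_integral_eq_lintegral_ofReal]
    · refine lintegral_congr fun w => ?_
      rw [← ENNReal.ofReal_mul (by positivity)]
    · rw [← IntegrableOn, ← integrableOn_Icc_iff_integrableOn_Ioc]
      exact (ContinuousOn.mul (by fun_prop) (hcont _)).integrableOn_Icc
    · refine (ae_restrict_iff' measurableSet_Ioc).2 (ae_of_all _ fun w hw => ?_)
      exact mul_nonneg (by positivity) (jointMgf_pos (hpos _ (by linarith [hw.1])) _).le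
  simp_rw [hI, mul_add, Finset.sum_add_distrib]
  rw [← Finset.sum_mul, hsum, one_mul, expMeasure_Ioi hy', max_eq_left hτ,
    ← ENNReal.ofReal_mul (Real.exp_pos _).le]
  have hint : ∀ i, IntervalIntegrable (fun w => r * Real.exp (-(r * w)) *
      jointMgf α u (τ - w) (y + Pi.single i (α i))) volume 0 τ := fun i =>
    ContinuousOn.intervalIntegrable (by
      rw [Set.uIcc_of_le hτ]; exact ContinuousOn.mul (by fun_prop) (hcont _))
  have hnn : ∀ i, 0 ≤ ∫ w in (0 : ℝ)..τ, r * Real.exp (-(r * w)) *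
      jointMgf α u (τ - w) (y + Pi.single i (α i)) := fun i =>
    intervalIntegral.integral_nonneg hτ fun w hw => mul_nonneg (by positivity)
      (jointMgf_pos (hpos _ (by linarith [hw.1])) _).le
  simp_rw [← ENNReal.ofReal_mul (hp _)]
  rw [← ENNReal.ofReal_sum_of_nonneg fun i _ => mul_nonneg (hp i) (hnn i),
    ← ENNReal.ofReal_add (by positivity) (Finset.sum_nonneg fun i _ => mul_nonneg (hp i) (hnn i))]
  congr 1
  simp_rw [← intervalIntegral.integral_const_mul]
  rw [← intervalIntegral.integral_finsetSum fun i _ => (hint i).const_mul _]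
  -- An explicit antiderivative: differentiating e^{-rw} produces a term in r that cancels the loss
  -- term of the backward equation, leaving only the gain terms.
  have hd : ∀ w ∈ Set.uIcc 0 τ, HasDerivAt (fun w => -(Real.exp (-(r * w)) *
      jointMgf α u (τ - w) y)) (∑ i, y i / r * (r * Real.exp (-(r * w)) *
        jointMgf α u (τ - w) (y + Pi.single i (α i)))) w := by
    intro w hw
    rw [Set.uIcc_of_le hτ] at hw
    have h1 : HasDerivAt (fun w => τ - w) (-1) w := by
      simpa using (hasDerivAt_id w).const_sub τ
    have h2 := (hasDerivAt_jointMgf hα (hpos (τ - w) (by linarith [hw.1])) y).comp w h1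
    have h3 : HasDerivAt (fun w => -(r * w)) (-r) w := by
      simpa using (hasDerivAt_id w).const_mul (-r)
    refine (h3.exp.mul h2).neg.congr_deriv ?_
    have h4 : ∑ i, y i / r * (r * Real.exp (-(r * w)) *
        jointMgf α u (τ - w) (y + Pi.single i (α i))) = Real.exp (-(r * w)) *
        ∑ i, y i * jointMgf α u (τ - w) (y + Pi.single i (α i)) := by
      rw [Finset.mul_sum]
      refine Finset.sum_congr rfl fun i _ => ?_
      field_simp
    rw [h4, ← hr]
    simp only [Function.comp_apply]
    ring
  rw [intervalIntegral.integral_eq_sub_of_hasDerivAt hd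
    (by
      convert! IntervalIntegrable.sum Finset.univ fun i _ => (hint i).const_mul (y i / r) using 1
      ext w
      simp)]
  simp [jointMgf_zero_time hα]
  ring

/-! ### Positions and histories of the walk -/

section Position

variable {Ω : Type*} {c : ℕ} {α x : Fin c → ℝ} {I : ℕ → Ω → Fin c}

lemma polyaPosition_succ (n : ℕ) (ω : Ω) :
    polyaPosition (Matrix.diagonal α) x I (n + 1) ω =
      polyaPosition (Matrix.diagonal α) x I n ω + Pi.single (I n ω) (α (I n ω)) := by
  simp only [polyaPosition, Finset.sum_range_succ, ← add_assoc]
  congr 1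
  ext k
  by_cases hk : k = I n ω
  · subst hk; simp
  · simp [Matrix.diagonal_apply_ne' _ hk, hk]

lemma polyaPosition_ge (hα : ∀ i, 0 < α i) (n : ℕ) (ω : Ω) (i : Fin c) :
    x i ≤ polyaPosition (Matrix.diagonal α) x I n ω i := by
  induction n with
  | zero => simp [polyaPosition]
  | succ n ih =>
    rw [polyaPosition_succ, Pi.add_apply]
    have : (0 : Fin c → ℝ) i ≤ (Pi.single (I n ω) (α (I n ω)) : Fin c → ℝ) i :=
      Pi.single_nonneg.2 (hα _).le i
    simp only [Pi.zero_apply] at this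
    linarith

lemma sum_polyaPosition_pos (hα : ∀ i, 0 < α i) (hx : ∀ i, 0 ≤ x i) (hx₀ : x ≠ 0) (n : ℕ) (ω : Ω) :
    0 < ∑ i, polyaPosition (Matrix.diagonal α) x I n ω i := by
  obtain ⟨i, hi⟩ := Function.ne_iff.1 hx₀
  refine Finset.sum_pos' (fun i _ => (hx i).trans (polyaPosition_ge hα n ω i))
    ⟨i, Finset.mem_univ i, ?_⟩
  exact ((hx i).lt_of_ne' hi).trans_le (polyaPosition_ge hα n ω i)

/-- Measured in units of its own increment, each coordinate counts renewals of its type. This turns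
a bound by a power of ρ at a position into geometric decay in `n`. -/
lemma sum_polyaPosition_div (hα : ∀ i, 0 < α i) (n : ℕ) (ω : Ω) :
    ∑ i, polyaPosition (Matrix.diagonal α) x I n ω i / α i = (∑ i, x i / α i) + n := by
  induction n with
  | zero => simp [polyaPosition]
  | succ n ih =>
    simp only [polyaPosition_succ, Pi.add_apply, add_div, Finset.sum_add_distrib, ih]
    have : ∑ i, (Pi.single (I n ω) (α (I n ω)) : Fin c → ℝ) i / α i = 1 := by
      rw [Finset.sum_eq_single (I n ω)]
      · simp [(hα _).ne']
      · intro k _ hk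
        simp [hk]
      · simp
    simp [this, add_assoc]

end Position

section History

variable {Ω : Type*} {c : ℕ} {A : Matrix (Fin c) (Fin c) ℝ} {x : Fin c → ℝ} {W : ℕ → Ω → ℝ}
  {I : ℕ → Ω → Fin c}

lemma measurable_renewalHistory_renewalEpoch (n : ℕ) :
    Measurable[renewalHistory W I n] (renewalEpoch W n) := by
  have : renewalEpoch W n = (fun p : Fin n → ℝ × Fin c => ∑ k, (p k).1) ∘
      fun ω (k : Fin n) => (W k ω, I k ω) := by
    ext ω
    simp [renewalEpoch, Fin.sum_univ_eq_sum_range (fun k => W k ω)]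
  rw [this]
  exact Measurable.comp (by fun_prop) (comap_measurable _)

lemma measurable_renewalHistory_type (n : ℕ) :
    Measurable[renewalHistory W I n] fun ω (k : Fin n) => I k ω := by
  have : (fun ω (k : Fin n) => I k ω) = (fun (p : Fin n → ℝ × Fin c) k => (p k).2) ∘
      fun ω (k : Fin n) => (W k ω, I k ω) := rfl
  rw [this]
  exact Measurable.comp (by fun_prop) (comap_measurable _)

lemma polyaPosition_eq_of_type_eq {n : ℕ} {ω : Ω} {j : Fin n → Fin c}
    (hj : (fun k : Fin n => I k ω) = j) :
    polyaPosition A x I n ω = x + ∑ k, A.row (j k) := by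
  subst hj
  rw [polyaPosition, Fin.sum_univ_eq_sum_range (fun k => A.row (I k ω))]

end History

/-! ### Joint law of a renewal epoch and the next waiting time -/

section Driven

variable {Ω : Type*} [MeasurableSpace Ω] {c : ℕ} {P : Measure Ω}
  {A : Matrix (Fin c) (Fin c) ℝ} {x : Fin c → ℝ} {X : ℝ≥0 → Ω → Fin c → ℝ} {W : ℕ → Ω → ℝ}
  {I : ℕ → Ω → Fin c}

namespace IsDrivenBy

lemma renewalHistory_le (h : IsDrivenBy P A x X W I) (n : ℕ) :
    renewalHistory W I n ≤ ‹MeasurableSpace Ω› :=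
  Measurable.comap_le (measurable_pi_lambda _ fun k =>
    (h.measurable_wait k).prodMk (h.measurable_type k))

lemma measurable_renewalEpoch (h : IsDrivenBy P A x X W I) (n : ℕ) :
    Measurable (renewalEpoch W n) :=
  Finset.measurable_fun_sum _ fun k _ => h.measurable_wait k

lemma measurable_polyaPosition (h : IsDrivenBy P A x X W I) (n : ℕ) :
    Measurable (polyaPosition A x I n) :=
  measurable_const.add (Finset.measurable_fun_sum _ fun k _ =>
    (measurable_of_countable A.row).comp (h.measurable_type k))

/-- The conditional law integrated over a history event on which the position, hence the conditional
probability, is constant. -/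
lemma measure_wait_type [IsProbabilityMeasure P] (h : IsDrivenBy P A x X W I) {n : ℕ}
    {B : Set Ω} (hB : MeasurableSet[renewalHistory W I n] B) {y : Fin c → ℝ}
    (hBy : ∀ ω ∈ B, polyaPosition A x I n ω = y) (i : Fin c) {w : ℝ} (hw : 0 ≤ w) :
    P (B ∩ {ω | w < W n ω ∧ I n ω = i}) =
      P B * ENNReal.ofReal (Real.exp (-(w * ∑ j, y j)) * (y i / ∑ j, y j)) := by
  have hm : MeasurableSet {ω | w < W n ω ∧ I n ω = i} :=
    (measurableSet_lt measurable_const (h.measurable_wait n)).inter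
      (h.measurable_type n (measurableSet_singleton i))
  have hle := h.renewalHistory_le n
  have h1 : ∫ ω in B, (P⟦{ω | w < W n ω ∧ I n ω = i} | renewalHistory W I n⟧) ω ∂P =
      P.real (B ∩ {ω | w < W n ω ∧ I n ω = i}) := by
    rw [setIntegral_condExp hle ((integrable_const 1).indicator hm) hB,
      integral_indicator hm, Measure.restrict_restrict hm, Set.inter_comm]
    simp
  have h2 : ∫ ω in B, (P⟦{ω | w < W n ω ∧ I n ω = i} | renewalHistory W I n⟧) ω ∂P =
      P.real B * (Real.exp (-(w * ∑ j, y j)) * (y i / ∑ j, y j)) := by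
    rw [setIntegral_congr_ae (g := fun _ => Real.exp (-(w * ∑ j, y j)) * (y i / ∑ j, y j))
      (hle _ hB)]
    · simp
    · filter_upwards [h.condProb_renewal n i w hw] with ω hω hωB
      rw [hω, hBy ω hωB]
  rw [← ofReal_measureReal, ← h1, h2, ENNReal.ofReal_mul measureReal_nonneg, ofReal_measureReal]

lemma ae_wait_pos [IsProbabilityMeasure P] (h : IsDrivenBy P A x X W I)
    (hS : ∀ n ω, 0 < ∑ i, polyaPosition A x I n ω i) (n : ℕ) : ∀ᵐ ω ∂P, 0 < W n ω := by
  have hle := h.renewalHistory_le n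
  have hm : ∀ i, MeasurableSet {ω | 0 < W n ω ∧ I n ω = i} := fun i =>
    (measurableSet_lt measurable_const (h.measurable_wait n)).inter
      (h.measurable_type n (measurableSet_singleton i))
  -- At `w = 0` the exponential factor is 1 and the type probabilities sum to 1.
  have h0 : ∫ ω, ∑ i, (P⟦{ω | 0 < W n ω ∧ I n ω = i} | renewalHistory W I n⟧) ω ∂P = 1 := by
    have : (fun ω => ∑ i, (P⟦{ω | 0 < W n ω ∧ I n ω = i} | renewalHistory W I n⟧) ω)
        =ᵐ[P] fun _ => 1 := by
      filter_upwards [ae_all_iff.2 fun i => h.condProb_renewal n i 0 le_rfl] with ω hω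
      simp only [hω]
      simp [← Finset.sum_div, div_self (hS n ω).ne']
    rw [integral_congr_ae this]
    simp
  rw [integral_finsetSum _ fun i _ => integrable_condExp] at h0
  simp_rw [integral_condExp hle, integral_indicator (hm _)] at h0
  simp only [integral_const, smul_eq_mul, mul_one, measureReal_restrict_apply_univ] at h0
  rw [← measureReal_biUnion_finset (fun i _ k _ hik => Set.disjoint_left.2 fun ω h1 h2 =>
    hik (h1.2.symm.trans h2.2)) fun i _ => hm i] at h0
  have h3 : (⋃ i ∈ (Finset.univ : Finset (Fin c)), {ω | 0 < W n ω ∧ I n ω = i}) =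
      {ω | 0 < W n ω} := by
    ext ω; simp
  have hm0 : MeasurableSet {ω | 0 < W n ω} := measurableSet_lt measurable_const (h.measurable_wait n)
  rw [h3, measureReal_def, ENNReal.toReal_eq_one_iff] at h0
  exact (prob_compl_eq_zero_iff hm0).2 h0

lemma ae_renewalEpoch_nonneg [IsProbabilityMeasure P] (h : IsDrivenBy P A x X W I)
    (hS : ∀ n ω, 0 < ∑ i, polyaPosition A x I n ω i) (n : ℕ) :
    ∀ᵐ ω ∂P, 0 ≤ renewalEpoch W n ω := by
  filter_upwards [ae_all_iff.2 (h.ae_wait_pos hS)] with ω hω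
  exact Finset.sum_nonneg fun k _ => (hω k).le

/-- Once position and next type are fixed, the epoch and the next waiting time are independent. It
is enough to test on products of a Borel set with a half-line, where `measure_wait_type` applies. -/
lemma map_epoch_wait [IsProbabilityMeasure P] (h : IsDrivenBy P A x X W I)
    (hS : ∀ n ω, 0 < ∑ i, polyaPosition A x I n ω i) {n : ℕ}
    {B : Set Ω} (hB : MeasurableSet[renewalHistory W I n] B) {y : Fin c → ℝ}
    (hBy : ∀ ω ∈ B, polyaPosition A x I n ω = y) (hy : 0 < ∑ j, y j) (i : Fin c) :
    (P.restrict (B ∩ {ω | I n ω = i})).map (fun ω => (renewalEpoch W n ω, W n ω)) =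
      (ENNReal.ofReal (y i / ∑ j, y j) • (P.restrict B).map (renewalEpoch W n)).prod
        (expMeasure (∑ j, y j)) := by
  have hle := h.renewalHistory_le n
  have hT := h.measurable_renewalEpoch n
  have := isProbabilityMeasure_expMeasure hy
  have hmT : Measurable fun ω => (renewalEpoch W n ω, W n ω) := hT.prodMk (h.measurable_wait n)
  have hI : MeasurableSet {ω | I n ω = i} := h.measurable_type n (measurableSet_singleton i)
  set ν := ENNReal.ofReal (y i / ∑ j, y j) • (P.restrict B).map (renewalEpoch W n) with hν
  have : IsFiniteMeasure ν := Measure.smul_finite _ ENNReal.ofReal_ne_top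
  symm
  refine Measure.prod_eq_generateFrom (C := {s | MeasurableSet s}) (D := Set.range Set.Ioi)
    MeasurableSpace.generateFrom_measurableSet ?_ MeasurableSpace.isPiSystem_measurableSet isPiSystem_Ioi
    ν.toFiniteSpanningSetsIn
    { set := fun n => Set.Ioi (-n : ℝ)
      set_mem := fun n => ⟨_, rfl⟩
      finite := fun n => measure_lt_top _ _
      spanning := ?_ } ?_
  · rw [← borel_eq_generateFrom_Ioi ℝ, BorelSpace.measurable_eq (α := ℝ)]
  · refine Set.eq_univ_of_forall fun w => ?_
    obtain ⟨k, hk⟩ := exists_nat_gt (-w)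
    exact Set.mem_iUnion.2 ⟨k, by simp only [Set.mem_Ioi]; linarith⟩
  · rintro s (hs : MeasurableSet s) _ ⟨w, rfl⟩
    rw [Measure.map_apply hmT (hs.prod measurableSet_Ioi),
      Measure.restrict_apply (hmT (hs.prod measurableSet_Ioi)), expMeasure_Ioi hy, hν,
      Measure.smul_apply, Measure.map_apply hT hs, Measure.restrict_apply (hT hs), smul_eq_mul]
    have hBs : MeasurableSet[renewalHistory W I n] (renewalEpoch W n ⁻¹' s ∩ B) :=
      (measurable_renewalHistory_renewalEpoch n hs).inter hB
    -- The conditional law is only given at nonnegative levels, hence `max w 0`; almost sure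
    -- positivity of the waiting time makes the two events agree.
    have key := h.measure_wait_type hBs (fun ω hω => hBy ω hω.2) i (le_max_right w 0)
    rw [ENNReal.ofReal_mul (Real.exp_pos _).le, mul_comm (max w 0)] at key
    rw [mul_right_comm, mul_comm, mul_comm (ENNReal.ofReal (y i / _)), ← key]
    refine measure_congr ?_
    filter_upwards [h.ae_wait_pos hS n] with ω hω
    refine propext ?_
    change ((renewalEpoch W n ω ∈ s ∧ w < W n ω) ∧ ω ∈ B ∧ I n ω = i) ↔
      ((renewalEpoch W n ω ∈ s ∧ ω ∈ B) ∧ max w 0 < W n ω ∧ I n ω = i)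
    rw [max_lt_iff]
    tauto

end IsDrivenBy

end Driven

lemma lintegral_eq_sum_fiber {Ω κ : Type*} [MeasurableSpace Ω] [Fintype κ] [MeasurableSpace κ]
    [MeasurableSingletonClass κ] {P : Measure Ω} {f : Ω → κ} (hf : Measurable f)
    (F : Ω → ENNReal) : ∫⁻ ω, F ω ∂P = ∑ k, ∫⁻ ω in {ω | f ω = k}, F ω ∂P := by
  have hU : (⋃ k, {ω | f ω = k}) = Set.univ := by
    ext ω; simp
  rw [← setLIntegral_univ, ← hU, lintegral_iUnion, tsum_fintype]
  · exact fun k => hf (measurableSet_singleton k)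
  · exact fun k l hkl => Set.disjoint_left.2 fun ω h1 h2 => hkl (h1.symm.trans h2)

/-! ### Comparison of generating functions at nearby arguments -/

/-- A larger argument dominates the base uniformly on bounded time intervals. -/
lemma eventually_mgfBase_le_mul {a u u' t : ℝ} (ha : 0 < a) (hu : u < u')
    (h : 0 < mgfBase a u t) :
    ∀ᶠ ρ in 𝓝[<] (1 : ℝ), ∀ σ ∈ Set.Icc 0 t, mgfBase a u' σ ≤ ρ * mgfBase a u σ := by
  -- Passing from `u` to `u'` lowers the base by `exp (a * σ) * δ`, at least `δ`, while the base at
  -- `u` never exceeds `M`. Any ratio in `(1 - δ / M, 1)` therefore works for all times at once.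
  set δ := Real.exp (-(a * u)) - Real.exp (-(a * u')) with hδ
  set M := 1 + Real.exp (a * t) * Real.exp (-(a * u)) with hM
  have hM0 : 0 < M := by positivity
  have hδ0 : 0 < δ := sub_pos.2 (Real.exp_lt_exp.2 (by nlinarith))
  have h1 : 1 - δ / M < 1 := by linarith [div_pos hδ0 hM0]
  filter_upwards [Ioo_mem_nhdsLT h1] with ρ hρ σ hσ
  have hpos := mgfBase_pos_of_le ha hσ.2 h
  have h2 : mgfBase a u' σ = mgfBase a u σ - Real.exp (a * σ) * δ := by
    simp only [mgfBase, hδ]; ring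
  have h3 : 1 ≤ Real.exp (a * σ) := Real.one_le_exp (mul_nonneg ha.le hσ.1)
  have h4 : mgfBase a u σ ≤ M := by
    have : Real.exp (a * σ) * Real.exp (-(a * u)) ≤ Real.exp (a * t) * Real.exp (-(a * u)) := by
      gcongr; exact hσ.2
    simp only [mgfBase, hM]
    linarith
  have h5 : δ / M * mgfBase a u σ ≤ δ := by
    calc δ / M * mgfBase a u σ ≤ δ / M * M := by gcongr
      _ = δ := div_mul_cancel₀ _ hM0.ne'
  have h6 : (1 - δ / M) * mgfBase a u σ ≤ ρ * mgfBase a u σ := by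
    gcongr; exact hρ.1.le
  nlinarith

lemma exists_gt_mgfBase_pos {a u t : ℝ} (h : 0 < mgfBase a u t) :
    ∃ u' > u, 0 < mgfBase a u' t := by
  have hc : ContinuousAt (fun u => mgfBase a u t) u := by
    unfold mgfBase; fun_prop
  have h1 : ∀ᶠ u' in 𝓝[>] u, 0 < mgfBase a u' t :=
    (hc.eventually (lt_mem_nhds h)).filter_mono nhdsWithin_le_nhds
  obtain ⟨u', h2, h3⟩ := (h1.and self_mem_nhdsWithin).exists
  exact ⟨u', h3, h2⟩

lemma jointMgf_le_rpow_mul {ι : Type*} [Fintype ι] {α u u' y : ι → ℝ} {ρ σ : ℝ}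
    (hα : ∀ i, 0 < α i) (hy : ∀ i, 0 ≤ y i) (hρ : 0 < ρ)
    (h : ∀ i, 0 < mgfBase (α i) (u i) σ) (h' : ∀ i, 0 < mgfBase (α i) (u' i) σ)
    (hle : ∀ i, mgfBase (α i) (u' i) σ ≤ ρ * mgfBase (α i) (u i) σ) :
    jointMgf α u σ y ≤ ρ ^ (∑ i, y i / α i) * jointMgf α u' σ y := by
  rw [Real.rpow_sum_of_pos hρ, jointMgf, jointMgf, ← Finset.prod_mul_distrib]
  refine Finset.prod_le_prod (fun i _ => Real.rpow_nonneg (h i).le _) fun i _ => ?_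
  have hp : 0 ≤ y i / α i := div_nonneg (hy i) (hα i).le
  have h1 := Real.rpow_le_rpow_of_nonpos (h' i) (hle i) (neg_nonpos.2 hp)
  rw [Real.mul_rpow hρ.le (h i).le] at h1
  calc mgfBase (α i) (u i) σ ^ (-(y i / α i))
      = ρ ^ (y i / α i) * (ρ ^ (-(y i / α i)) * mgfBase (α i) (u i) σ ^ (-(y i / α i))) := by
        rw [← mul_assoc, ← Real.rpow_add hρ, add_neg_cancel, Real.rpow_zero, one_mul]
    _ ≤ _ := by gcongr

/-! ### Iterating over renewals: non-explosion and the joint generating function -/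

section Driven

variable {Ω : Type*} [MeasurableSpace Ω] {c : ℕ} {P : Measure Ω}
  {α u x : Fin c → ℝ} {X : ℝ≥0 → Ω → Fin c → ℝ} {W : ℕ → Ω → ℝ} {I : ℕ → Ω → Fin c}

namespace IsDrivenBy

/-- By `map_epoch_wait` the next waiting time can be integrated out first; for a fixed epoch not
after `t`, what remains is the first-renewal equation with the remaining time. Later epochs
contribute nothing, the wait being almost surely positive. -/
lemma sum_lintegral_renewal [IsProbabilityMeasure P]
    (h : IsDrivenBy P (Matrix.diagonal α) x X W I) (hα : ∀ i, 0 < α i)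
    (hS : ∀ n ω, 0 < ∑ i, polyaPosition (Matrix.diagonal α) x I n ω i) {t : ℝ}
    (hu : ∀ i, 0 < mgfBase (α i) (u i) t) {n : ℕ}
    {B : Set Ω} (hB : MeasurableSet[renewalHistory W I n] B) {y : Fin c → ℝ}
    (hBy : ∀ ω ∈ B, polyaPosition (Matrix.diagonal α) x I n ω = y)
    (hy : ∀ i, 0 ≤ y i) (hy' : 0 < ∑ i, y i) :
    ∑ i, ∫⁻ ω in B ∩ {ω | I n ω = i},
        ((if renewalEpoch W n ω ≤ t ∧ t < renewalEpoch W n ω + W n ω then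
            ENNReal.ofReal (Real.exp (∑ i, u i * y i)) else 0) +
          if renewalEpoch W n ω + W n ω ≤ t then
            ENNReal.ofReal (jointMgf α u (t - (renewalEpoch W n ω + W n ω))
              (y + Pi.single i (α i))) else 0) ∂P =
      ∫⁻ ω in B, (if renewalEpoch W n ω ≤ t then
        ENNReal.ofReal (jointMgf α u (t - renewalEpoch W n ω) y) else 0) ∂P := by
  have hT := h.measurable_renewalEpoch n
  have hTW : Measurable fun ω => (renewalEpoch W n ω, W n ω) := hT.prodMk (h.measurable_wait n)
  have := isProbabilityMeasure_expMeasure hy'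
  let G : Fin c → ℝ × ℝ → ENNReal := fun i q =>
    (if q.1 ≤ t ∧ t < q.1 + q.2 then ENNReal.ofReal (Real.exp (∑ i, u i * y i)) else 0) +
      if q.1 + q.2 ≤ t then
        ENNReal.ofReal (jointMgf α u (t - (q.1 + q.2)) (y + Pi.single i (α i))) else 0
  have hG : ∀ i, Measurable (G i) := by
    intro i
    refine Measurable.add (Measurable.ite ?_ measurable_const measurable_const)
      (Measurable.ite ?_ ?_ measurable_const)
    · exact (measurableSet_le measurable_fst measurable_const).inter
        (measurableSet_lt measurable_const (measurable_fst.add measurable_snd))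
    · exact measurableSet_le (by fun_prop) measurable_const
    · exact ((measurable_jointMgf _).comp (by fun_prop)).ennreal_ofReal
  have h1 : ∀ i, ∫⁻ ω in B ∩ {ω | I n ω = i}, G i (renewalEpoch W n ω, W n ω) ∂P =
      ∫⁻ ω in B, ENNReal.ofReal (y i / ∑ j, y j) *
        ∫⁻ w, G i (renewalEpoch W n ω, w) ∂expMeasure (∑ j, y j) ∂P := by
    intro i
    have hGi : Measurable fun s => ∫⁻ w, G i (s, w) ∂expMeasure (∑ j, y j) :=
      (hG i).lintegral_prod_right'
    have hc := lintegral_const_mul (μ := P.restrict B) (ENNReal.ofReal (y i / ∑ j, y j))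
      (hGi.comp hT)
    simp only [Function.comp_apply] at hc
    rw [← lintegral_map (hG i) hTW, h.map_epoch_wait hS hB hBy hy',
      lintegral_prod _ (hG i).aemeasurable, lintegral_smul_measure,
      lintegral_map hGi hT, hc, smul_eq_mul]
  change ∑ i, ∫⁻ ω in B ∩ {ω | I n ω = i}, G i (renewalEpoch W n ω, W n ω) ∂P = _
  simp_rw [h1]
  have hm : ∀ i, Measurable fun ω => ENNReal.ofReal (y i / ∑ j, y j) *
      ∫⁻ w, G i (renewalEpoch W n ω, w) ∂expMeasure (∑ j, y j) := fun i =>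
    (((hG i).lintegral_prod_right').comp hT).const_mul _
  rw [← lintegral_finsetSum _ fun i _ => hm i]
  refine lintegral_congr_ae ?_
  filter_upwards [ae_restrict_of_ae (h.ae_renewalEpoch_nonneg hS n)] with ω hω
  generalize renewalEpoch W n ω = s at hω
  split_ifs with hs
  · rw [← jointMgf_eq_first_renewal hα (sub_nonneg.2 hs)
      (fun i => mgfBase_pos_of_le (hα i) (by linarith) (hu i)) hy hy']
    refine Finset.sum_congr rfl fun i _ => ?_
    congr 1
    rw [← lintegral_indicator measurableSet_Iic, ← setLIntegral_const,
      ← lintegral_indicator measurableSet_Ioi,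
      ← lintegral_add_left (measurable_const.indicator measurableSet_Ioi)]
    refine lintegral_congr fun w => ?_
    simp only [G, Set.indicator_apply, Set.mem_Ioi, Set.mem_Iic, sub_lt_iff_lt_add', hs, true_and,
      le_sub_iff_add_le', sub_sub]
  · refine Finset.sum_eq_zero fun i _ => ?_
    have : ∀ᵐ w ∂expMeasure (∑ j, y j), G i (s, w) = 0 := by
      filter_upwards [ae_expMeasure_pos hy'] with w hw
      have : ¬ s + w ≤ t := fun h => hs (by linarith)
      simp [G, hs, this]
    rw [lintegral_congr_ae this]
    simp

/-- The expected value of `jointMgf` at the `n`-th renewal, split according to whether the walk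
is renewed again by time `t`. -/
lemma lintegral_jointMgf_renewal [IsProbabilityMeasure P]
    (h : IsDrivenBy P (Matrix.diagonal α) x X W I) (hα : ∀ i, 0 < α i) (hx : ∀ i, 0 ≤ x i)
    (hx₀ : x ≠ 0) {t : ℝ} (hu : ∀ i, 0 < mgfBase (α i) (u i) t) (n : ℕ) :
    ∫⁻ ω, (if renewalEpoch W n ω ≤ t then ENNReal.ofReal (jointMgf α u (t - renewalEpoch W n ω)
        (polyaPosition (Matrix.diagonal α) x I n ω)) else 0) ∂P =
      ∫⁻ ω in {ω | renewalEpoch W n ω ≤ t ∧ t < renewalEpoch W (n + 1) ω},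
        ENNReal.ofReal (Real.exp (∑ i, u i * polyaPosition (Matrix.diagonal α) x I n ω i)) ∂P +
      ∫⁻ ω, (if renewalEpoch W (n + 1) ω ≤ t then
        ENNReal.ofReal (jointMgf α u (t - renewalEpoch W (n + 1) ω)
          (polyaPosition (Matrix.diagonal α) x I (n + 1) ω)) else 0) ∂P := by
  have hS := fun n ω => sum_polyaPosition_pos (I := I) hα hx hx₀ n ω
  have hpos := fun n ω i => (hx i).trans (polyaPosition_ge (x := x) (I := I) hα n ω i)
  have hE : MeasurableSet {ω | renewalEpoch W n ω ≤ t ∧ t < renewalEpoch W (n + 1) ω} :=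
    (measurableSet_le (h.measurable_renewalEpoch n) measurable_const).inter
      (measurableSet_lt measurable_const (h.measurable_renewalEpoch (n + 1)))
  have hSm := h.measurable_polyaPosition n
  rw [← lintegral_indicator hE, ← lintegral_add_left (Measurable.indicator (by fun_prop) hE)]
  have hJ : Measurable fun ω (k : Fin n) => I k ω := by
    exact measurable_pi_lambda _ fun k => h.measurable_type k
  -- The position is a function of the types so far, so it is constant on each of these finitely
  -- many history events.
  rw [lintegral_eq_sum_fiber hJ, lintegral_eq_sum_fiber (P := P) hJ]
  refine Finset.sum_congr rfl fun j _ => ?_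
  have hB : MeasurableSet[renewalHistory W I n] {ω | (fun k : Fin n => I k ω) = j} :=
    measurable_renewalHistory_type n (measurableSet_singleton j)
  have hBm := h.renewalHistory_le n _ hB
  set B := {ω | (fun k : Fin n => I k ω) = j} with hBdef
  rcases B.eq_empty_or_nonempty with hemp | ⟨ω₀, hω₀⟩
  · simp [hemp]
  set y := polyaPosition (Matrix.diagonal α) x I n ω₀ with hydef
  have hBy : ∀ ω ∈ B, polyaPosition (Matrix.diagonal α) x I n ω = y := fun ω hω => by
    rw [hydef, polyaPosition_eq_of_type_eq hω, polyaPosition_eq_of_type_eq hω₀]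
  rw [setLIntegral_congr_fun (g := fun ω => if renewalEpoch W n ω ≤ t then
    ENNReal.ofReal (jointMgf α u (t - renewalEpoch W n ω) y) else 0) hBm
    (fun ω hω => by simp only [hBy ω hω]),
    ← h.sum_lintegral_renewal hα hS hu hB hBy (hpos n ω₀) (hS n ω₀),
    lintegral_eq_sum_fiber (P := P.restrict B) (h.measurable_type n)]
  refine Finset.sum_congr rfl fun i _ => ?_
  have hI : MeasurableSet {ω | I n ω = i} := h.measurable_type n (measurableSet_singleton i)
  rw [Measure.restrict_restrict hI, Set.inter_comm]
  refine setLIntegral_congr_fun (hI.inter hBm) fun ω hω => ?_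
  have h1 : renewalEpoch W (n + 1) ω = renewalEpoch W n ω + W n ω := Finset.sum_range_succ _ _
  have h2 : I n ω = i := hω.1
  simp only [Set.indicator_apply, Set.mem_ofPred_eq, polyaPosition_succ, h1, hBy ω hω.2, h2]

lemma tendsto_lintegral_jointMgf_renewal [IsProbabilityMeasure P]
    (h : IsDrivenBy P (Matrix.diagonal α) x X W I) (hα : ∀ i, 0 < α i) (hx : ∀ i, 0 ≤ x i)
    (hx₀ : x ≠ 0) {t : ℝ} (hu : ∀ i, 0 < mgfBase (α i) (u i) t) :
    Tendsto (fun n => ∫⁻ ω, (if renewalEpoch W n ω ≤ t then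
      ENNReal.ofReal (jointMgf α u (t - renewalEpoch W n ω)
        (polyaPosition (Matrix.diagonal α) x I n ω)) else 0) ∂P) atTop (𝓝 0) := by
  have hS := fun n ω => sum_polyaPosition_pos (I := I) hα hx hx₀ n ω
  have hpos := fun n ω i => (hx i).trans (polyaPosition_ge (x := x) (I := I) hα n ω i)
  -- Admissibility is an open condition, so there is room to enlarge every `u i`. The remainders at
  -- `u'` are bounded by the same identity, and `ρ` measures the gain from returning to `u`.
  choose u' huu' hu' using fun i => exists_gt_mgfBase_pos (hu i)
  obtain ⟨ρ, hρ, hρ0, hρ1⟩ := ((eventually_all.2 fun i =>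
    eventually_mgfBase_le_mul (hα i) (huu' i) (hu i)).and
      (Ioo_mem_nhdsLT (zero_lt_one (α := ℝ)))).exists
  have hbound : ∀ n, ∫⁻ ω, (if renewalEpoch W n ω ≤ t then
      ENNReal.ofReal (jointMgf α u' (t - renewalEpoch W n ω)
        (polyaPosition (Matrix.diagonal α) x I n ω)) else 0) ∂P ≤
      ENNReal.ofReal (jointMgf α u' t x) + 1 := by
    intro n
    induction n with
    | zero =>
      simp only [renewalEpoch, polyaPosition, Finset.range_zero, Finset.sum_empty,
        sub_zero, add_zero]
      rw [lintegral_const, measure_univ, mul_one]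
      split_ifs
      · exact le_self_add
      · exact zero_le
    | succ n ih =>
      rw [h.lintegral_jointMgf_renewal hα hx hx₀ hu' n] at ih
      exact le_add_self.trans ih
  have hle : ∀ n, ∫⁻ ω, (if renewalEpoch W n ω ≤ t then
      ENNReal.ofReal (jointMgf α u (t - renewalEpoch W n ω)
        (polyaPosition (Matrix.diagonal α) x I n ω)) else 0) ∂P ≤
      ENNReal.ofReal (ρ ^ n) * (ENNReal.ofReal (jointMgf α u' t x) + 1) := by
    intro n
    refine le_trans ?_ (mul_le_mul_right (hbound n) _)
    rw [← lintegral_const_mul' _ _ ENNReal.ofReal_ne_top]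
    refine lintegral_mono_ae ?_
    filter_upwards [h.ae_renewalEpoch_nonneg hS n] with ω hω
    split_ifs with hs
    · rw [← ENNReal.ofReal_mul (by positivity)]
      refine ENNReal.ofReal_le_ofReal ?_
      have hd' := fun i => mgfBase_pos_of_le (σ := t - renewalEpoch W n ω) (hα i)
        (by linarith) (hu' i)
      refine (jointMgf_le_rpow_mul hα (hpos n ω) hρ0
        (fun i => mgfBase_pos_of_le (hα i) (by linarith) (hu i)) hd'
        (fun i => hρ i _ ⟨by linarith, by linarith⟩)).trans ?_
      refine mul_le_mul_of_nonneg_right ?_ (jointMgf_pos hd' _).le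
      rw [sum_polyaPosition_div hα, ← Real.rpow_natCast]
      refine Real.rpow_le_rpow_of_exponent_ge hρ0 hρ1.le ?_
      linarith [Finset.sum_nonneg fun i (_ : i ∈ Finset.univ) => div_nonneg (hx i) (hα i).le]
    · simp
  refine tendsto_of_tendsto_of_tendsto_of_le_of_le tendsto_const_nhds ?_ (fun _ => zero_le) hle
  have h1 : Tendsto (fun n : ℕ => ENNReal.ofReal (ρ ^ n)) atTop (𝓝 0) := by
    simpa using ENNReal.tendsto_ofReal (tendsto_pow_atTop_nhds_zero_of_lt_one hρ0.le hρ1)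
  simpa using ENNReal.Tendsto.mul_const h1
    (Or.inr (ENNReal.add_ne_top.2 ⟨ENNReal.ofReal_ne_top, ENNReal.one_ne_top⟩))

/-- Telescoping `lintegral_jointMgf_renewal` and letting the remainder vanish. No path of the
process is involved yet, so this can also be used to rule out explosion. -/
lemma tsum_lintegral_renewal [IsProbabilityMeasure P]
    (h : IsDrivenBy P (Matrix.diagonal α) x X W I) (hα : ∀ i, 0 < α i) (hx : ∀ i, 0 ≤ x i)
    (hx₀ : x ≠ 0) {t : ℝ} (ht : 0 ≤ t) (hu : ∀ i, 0 < mgfBase (α i) (u i) t) :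
    ∑' n, ∫⁻ ω in {ω | renewalEpoch W n ω ≤ t ∧ t < renewalEpoch W (n + 1) ω},
      ENNReal.ofReal (Real.exp (∑ i, u i * polyaPosition (Matrix.diagonal α) x I n ω i)) ∂P =
      ENNReal.ofReal (jointMgf α u t x) := by
  set a := fun n => ∫⁻ ω in {ω | renewalEpoch W n ω ≤ t ∧ t < renewalEpoch W (n + 1) ω},
    ENNReal.ofReal (Real.exp (∑ i, u i * polyaPosition (Matrix.diagonal α) x I n ω i)) ∂P
  have hsum : ∀ n, ENNReal.ofReal (jointMgf α u t x) = ∑ k ∈ Finset.range n, a k +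
      ∫⁻ ω, (if renewalEpoch W n ω ≤ t then
      ENNReal.ofReal (jointMgf α u (t - renewalEpoch W n ω)
        (polyaPosition (Matrix.diagonal α) x I n ω)) else 0) ∂P := by
    intro n
    induction n with
    | zero => simp [renewalEpoch, polyaPosition, ht]
    | succ n ih =>
      rw [ih, h.lintegral_jointMgf_renewal hα hx hx₀ hu n, Finset.sum_range_succ, add_assoc]
  have h1 := (ENNReal.tendsto_nat_tsum a).add
    (h.tendsto_lintegral_jointMgf_renewal hα hx hx₀ hu)
  simp_rw [← hsum, add_zero] at h1
  exact tendsto_nhds_unique tendsto_const_nhds h1 |>.symm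

lemma aedisjoint_renewal [IsProbabilityMeasure P]
    (h : IsDrivenBy P (Matrix.diagonal α) x X W I)
    (hS : ∀ n ω, 0 < ∑ i, polyaPosition (Matrix.diagonal α) x I n ω i) (t : ℝ) :
    Pairwise (Function.onFun (AEDisjoint P) fun n =>
      {ω | renewalEpoch W n ω ≤ t ∧ t < renewalEpoch W (n + 1) ω}) := by
  have hlt : ∀ n m, n < m → AEDisjoint P
      {ω | renewalEpoch W n ω ≤ t ∧ t < renewalEpoch W (n + 1) ω}
      {ω | renewalEpoch W m ω ≤ t ∧ t < renewalEpoch W (m + 1) ω} := by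
    intro n m hnm
    refine measure_eq_zero_iff_ae_notMem.2 ?_
    filter_upwards [ae_all_iff.2 (h.ae_wait_pos hS)] with ω hω hmem
    have : renewalEpoch W (n + 1) ω ≤ renewalEpoch W m ω :=
      Finset.sum_le_sum_of_subset_of_nonneg (Finset.range_mono hnm) fun k _ _ => (hω k).le
    linarith [hmem.1.2, hmem.2.1]
  intro n m hnm
  rcases lt_or_gt_of_ne hnm with h1 | h1
  · exact hlt n m h1
  · exact (hlt m n h1).symm

lemma measurableSet_renewal (h : IsDrivenBy P (Matrix.diagonal α) x X W I) (t : ℝ) (n : ℕ) :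
    MeasurableSet {ω | renewalEpoch W n ω ≤ t ∧ t < renewalEpoch W (n + 1) ω} :=
  (measurableSet_le (h.measurable_renewalEpoch n) measurable_const).inter
    (measurableSet_lt measurable_const (h.measurable_renewalEpoch (n + 1)))

/-- The walk does not explode: almost surely, only finitely many renewals occur by time `t`. -/
lemma ae_mem_iUnion_renewal [IsProbabilityMeasure P]
    (h : IsDrivenBy P (Matrix.diagonal α) x X W I) (hα : ∀ i, 0 < α i) (hx : ∀ i, 0 ≤ x i)
    (hx₀ : x ≠ 0) {t : ℝ} (ht : 0 ≤ t) :
    ∀ᵐ ω ∂P, ω ∈ ⋃ n, {ω | renewalEpoch W n ω ≤ t ∧ t < renewalEpoch W (n + 1) ω} := by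
  have hS := fun n ω => sum_polyaPosition_pos (I := I) hα hx hx₀ n ω
  -- At argument 0 both the integrands and the generating function equal 1, so the probabilities of
  -- exactly `n` renewals by time `t` add up to 1.
  have h1 := h.tsum_lintegral_renewal (u := 0) hα hx hx₀ ht (by simp [mgfBase_zero_left])
  simp only [jointMgf_zero, Pi.zero_apply, zero_mul, Finset.sum_const_zero, Real.exp_zero,
    ENNReal.ofReal_one, lintegral_const, one_mul, Measure.restrict_apply_univ] at h1
  rw [← measure_iUnion₀ (h.aedisjoint_renewal hS t)
    fun n => (h.measurableSet_renewal t n).nullMeasurableSet] at h1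
  exact (prob_compl_eq_zero_iff (MeasurableSet.iUnion (h.measurableSet_renewal t))).2 h1

lemma ae_exists_eq_polyaPosition [IsProbabilityMeasure P]
    (h : IsDrivenBy P (Matrix.diagonal α) x X W I) (hα : ∀ i, 0 < α i) (hx : ∀ i, 0 ≤ x i)
    (hx₀ : x ≠ 0) (t : ℝ≥0) :
    ∀ᵐ ω ∂P, ∃ n, X t ω = polyaPosition (Matrix.diagonal α) x I n ω := by
  filter_upwards [h.path_eq, h.ae_mem_iUnion_renewal hα hx hx₀ (NNReal.coe_nonneg t)] with ω h1 h2
  obtain ⟨n, hn⟩ := Set.mem_iUnion.1 h2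
  exact ⟨n, h1 n t hn.1 hn.2⟩

/-- The process is not assumed measurable; on each piece of an almost sure countable cover it agrees
almost everywhere with a measurable position. -/
lemma aemeasurable [IsProbabilityMeasure P]
    (h : IsDrivenBy P (Matrix.diagonal α) x X W I) (hα : ∀ i, 0 < α i) (hx : ∀ i, 0 ≤ x i)
    (hx₀ : x ≠ 0) (t : ℝ≥0) : AEMeasurable (X t) P := by
  rw [← Measure.restrict_eq_self_of_ae_mem (h.ae_mem_iUnion_renewal hα hx hx₀ (NNReal.coe_nonneg t)),
    aemeasurable_iUnion_iff]
  intro n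
  refine (h.measurable_polyaPosition n).aemeasurable.congr ?_
  refine (ae_restrict_iff' (h.measurableSet_renewal t n)).2 ?_
  filter_upwards [h.path_eq] with ω h1 h2
  exact (h1 n t h2.1 h2.2).symm

/-- The joint moment generating function of the walk. -/
lemma lintegral_exp_sum [IsProbabilityMeasure P]
    (h : IsDrivenBy P (Matrix.diagonal α) x X W I) (hα : ∀ i, 0 < α i) (hx : ∀ i, 0 ≤ x i)
    (hx₀ : x ≠ 0) {t : ℝ≥0} (hu : ∀ i, 0 < mgfBase (α i) (u i) t) :
    ∫⁻ ω, ENNReal.ofReal (Real.exp (∑ i, u i * X t ω i)) ∂P =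
      ENNReal.ofReal (jointMgf α u t x) := by
  have hS := fun n ω => sum_polyaPosition_pos (I := I) hα hx hx₀ n ω
  rw [← h.tsum_lintegral_renewal hα hx hx₀ (NNReal.coe_nonneg t) hu]
  nth_rewrite 1 [← Measure.restrict_eq_self_of_ae_mem (h.ae_mem_iUnion_renewal hα hx hx₀ (NNReal.coe_nonneg t))]
  rw [lintegral_iUnion₀ (fun n => (h.measurableSet_renewal t n).nullMeasurableSet)
    (h.aedisjoint_renewal hS t)]
  refine tsum_congr fun n => setLIntegral_congr_fun_ae (h.measurableSet_renewal t n) ?_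
  filter_upwards [h.path_eq] with ω h1 h2
  rw [h1 n t h2.1 h2.2]

lemma integrable_exp_sum [IsProbabilityMeasure P]
    (h : IsDrivenBy P (Matrix.diagonal α) x X W I) (hα : ∀ i, 0 < α i) (hx : ∀ i, 0 ≤ x i)
    (hx₀ : x ≠ 0) {t : ℝ≥0} (hu : ∀ i, 0 < mgfBase (α i) (u i) t) :
    Integrable (fun ω => Real.exp (∑ i, u i * X t ω i)) P := by
  have hX := aemeasurable_pi_iff.1 (h.aemeasurable hα hx hx₀ t)
  refine (lintegral_ofReal_ne_top_iff_integrable ?_ (ae_of_all _ fun _ => (Real.exp_pos _).le)).1 ?_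
  · exact (Real.measurable_exp.comp_aemeasurable
      (Finset.aemeasurable_fun_sum _ fun i _ => (hX i).const_mul _)).aestronglyMeasurable
  · rw [h.lintegral_exp_sum hα hx hx₀ hu]
    exact ENNReal.ofReal_ne_top

lemma integral_exp_sum [IsProbabilityMeasure P]
    (h : IsDrivenBy P (Matrix.diagonal α) x X W I) (hα : ∀ i, 0 < α i) (hx : ∀ i, 0 ≤ x i)
    (hx₀ : x ≠ 0) {t : ℝ≥0} (hu : ∀ i, 0 < mgfBase (α i) (u i) t) :
    ∫ ω, Real.exp (∑ i, u i * X t ω i) ∂P = jointMgf α u t x := by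
  rw [integral_eq_lintegral_of_nonneg_ae (ae_of_all _ fun _ => (Real.exp_pos _).le)
    (h.integrable_exp_sum hα hx hx₀ hu).aestronglyMeasurable, h.lintegral_exp_sum hα hx hx₀ hu,
    ENNReal.toReal_ofReal (jointMgf_pos hu x).le]

end IsDrivenBy

end Driven

/-! ### Continuity theorem for Laplace transforms on the orthant -/

section Laplace

open scoped BoundedContinuousFunction

variable {ι : Type*} [Fintype ι]

/-- The bounded continuous function `y ↦ exp (-∑ i, s i * y i)` on the nonnegative orthant. -/
noncomputable def expNegSum (s : ι → ℝ≥0) : (ι → ℝ≥0) →ᵇ ℝ :=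
  BoundedContinuousFunction.ofNormedAddCommGroup
    (fun y => Real.exp (-∑ i, (s i : ℝ) * y i)) (by fun_prop) 1 fun y => by
      rw [Real.norm_eq_abs, Real.abs_exp, Real.exp_le_one_iff, neg_nonpos]
      positivity

lemma expNegSum_apply (s y : ι → ℝ≥0) : expNegSum s y = Real.exp (-∑ i, (s i : ℝ) * y i) := rfl

lemma expNegSum_add (s s' : ι → ℝ≥0) : expNegSum (s + s') = expNegSum s * expNegSum s' := by
  ext y
  simp only [BoundedContinuousFunction.mul_apply, expNegSum_apply, ← Real.exp_add, Pi.add_apply,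
    NNReal.coe_add, add_mul, Finset.sum_add_distrib, neg_add]

lemma expNegSum_zero : expNegSum (0 : ι → ℝ≥0) = 1 := by
  ext y
  simp [expNegSum_apply]

/-- The algebra spanned by the functions `y ↦ exp (-∑ i, s i * y i)`. -/
noncomputable def expNegSumAlgebra (ι : Type*) [Fintype ι] :
    StarSubalgebra ℝ ((ι → ℝ≥0) →ᵇ ℝ) where
  toSubalgebra := Algebra.adjoin ℝ (Set.range expNegSum)
  star_mem' := fun {a} ha => by
    have : star a = a := by ext; simp
    rwa [this]

lemma separatesPoints_expNegSumAlgebra : ((expNegSumAlgebra ι).map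
    (BoundedContinuousFunction.toContinuousMapStarₐ ℝ)).SeparatesPoints := by
  classical
  intro y z hyz
  obtain ⟨i, hi⟩ := Function.ne_iff.1 hyz
  refine ⟨expNegSum (Pi.single i 1), ⟨_, ⟨_, Algebra.subset_adjoin ⟨Pi.single i 1, rfl⟩, rfl⟩, rfl⟩,
    ?_⟩
  have h : ∀ y : ι → ℝ≥0, ∑ k, ((Pi.single i 1 : ι → ℝ≥0) k : ℝ) * y k = y i := fun y => by
    rw [Finset.sum_eq_single i] <;> simp +contextual
  change ¬ Real.exp (-∑ k, _) = Real.exp (-∑ k, _)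
  rw [h, h, Real.exp_eq_exp, neg_inj, NNReal.coe_inj]
  exact hi

/-- **Continuity theorem for Laplace transforms**, for tight families. -/
lemma tendsto_of_tendsto_laplace {κ : Type*} {l : Filter κ}
    {μ : κ → ProbabilityMeasure (ι → ℝ≥0)} {μ₀ : ProbabilityMeasure (ι → ℝ≥0)}
    (hμ : IsTightMeasureSet {(μ n : Measure (ι → ℝ≥0)) | n})
    (h : ∀ s : ι → ℝ≥0, Tendsto (fun n => ∫ y : ι → ℝ≥0, Real.exp (-∑ i, (s i : ℝ) * y i) ∂(μ n)) l
      (𝓝 (∫ y : ι → ℝ≥0, Real.exp (-∑ i, (s i : ℝ) * y i) ∂μ₀))) :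
    Tendsto μ l (𝓝 μ₀) := by
  refine ProbabilityMeasure.tendsto_of_tight_of_separatesPoints ℝ hμ
    separatesPoints_expNegSumAlgebra fun g hg => ?_
  -- The exponentials are closed under multiplication, so the algebra they generate is just their
  -- linear span, and convergence extends by linearity.
  have hclosed : ∀ f ∈ Submonoid.closure (Set.range (expNegSum (ι := ι))),
      f ∈ Set.range (expNegSum (ι := ι)) := by
    intro f hf
    induction hf using Submonoid.closure_induction with
    | mem f hf => exact hf
    | one => exact ⟨0, expNegSum_zero⟩
    | mul f g _ _ hf hg =>
      obtain ⟨s, rfl⟩ := hf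
      obtain ⟨s', rfl⟩ := hg
      exact ⟨s + s', expNegSum_add s s'⟩
  have hg' : g ∈ Submodule.span ℝ (Set.range (expNegSum (ι := ι))) := by
    have h1 : g ∈ Subalgebra.toSubmodule (Algebra.adjoin ℝ (Set.range (expNegSum (ι := ι)))) := hg
    rw [Algebra.adjoin_eq_span] at h1
    exact Submodule.span_mono hclosed h1
  clear hg
  induction hg' using Submodule.span_induction with
  | mem f hf =>
    obtain ⟨s, rfl⟩ := hf
    exact h s
  | zero => simpa using tendsto_const_nhds
  | add f g _ _ ihf ihg =>
    simp only [BoundedContinuousFunction.add_apply]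
    simp_rw [integral_add (BoundedContinuousFunction.integrable _ f)
      (BoundedContinuousFunction.integrable _ g)]
    exact ihf.add ihg
  | smul a f _ ihf =>
    simp only [BoundedContinuousFunction.smul_apply, smul_eq_mul]
    simp_rw [integral_const_mul]
    exact ihf.const_mul a

end Laplace

/-! ### Laplace transform of the gamma law -/

section Gamma

lemma ae_nonneg_gammaLaw (k θ : ℝ) : ∀ᵐ y ∂gammaLaw k θ, 0 ≤ y := by
  unfold gammaLaw
  split_ifs with h
  · have h0 : gammaMeasure k θ⁻¹ (Set.Iio 0) = 0 := by
      rw [gammaMeasure, withDensity_apply _ measurableSet_Iio, lintegral_gammaPDF_of_nonpos le_rfl]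
    refine (measure_eq_zero_iff_ae_notMem.1 h0).mono fun y hy => not_lt.1 hy
  · simp [ae_dirac_eq]

lemma integral_exp_neg_mul_gammaLaw {k θ s : ℝ} (hk : 0 ≤ k) (hθ : 0 < θ) (hs : 0 ≤ s) :
    ∫ y, Real.exp (-(s * y)) ∂gammaLaw k θ = (1 + θ * s) ^ (-k) := by
  unfold gammaLaw
  rcases hk.eq_or_lt with rfl | hk
  · simp
  have hr : 0 < θ⁻¹ := inv_pos.2 hθ
  rw [if_pos ⟨hk, hθ⟩, gammaMeasure, integral_withDensity_eq_integral_toReal_smul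
    (f := gammaPDF k θ⁻¹) (measurable_gammaPDFReal _ _).ennreal_ofReal (by simp [gammaPDF])]
  have h1 : ∀ y, (gammaPDF k θ⁻¹ y).toReal • Real.exp (-(s * y)) =
      (Set.Ici 0).indicator (fun y => θ⁻¹ ^ k / Real.Gamma k *
        (y ^ (k - 1) * Real.exp (-((θ⁻¹ + s) * y)))) y := by
    intro y
    rw [gammaPDF, ENNReal.toReal_ofReal (gammaPDFReal_nonneg hk hr y), gammaPDFReal, smul_eq_mul,
      Set.indicator_apply]
    by_cases hy : 0 ≤ y
    · rw [if_pos hy, if_pos (by exact hy), add_mul, neg_add, Real.exp_add]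
      ring
    · rw [if_neg hy, if_neg (by exact hy), zero_mul]
  simp_rw [h1]
  rw [integral_indicator measurableSet_Ici, integral_Ici_eq_integral_Ioi, integral_const_mul,
    Real.integral_rpow_mul_exp_neg_mul_Ioi hk (by positivity)]
  have h2 : θ⁻¹ + s = θ⁻¹ * (1 + θ * s) := by field_simp
  have h3 : 0 < 1 + θ * s := by positivity
  have hG := (Real.Gamma_pos_of_pos hk).ne'
  rw [h2, one_div, Real.inv_rpow (mul_pos hr h3).le, Real.mul_rpow hr.le h3.le,
    Real.rpow_neg h3.le]
  have h4 := (Real.rpow_pos_of_pos hr k).ne'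
  have h5 := (Real.rpow_pos_of_pos h3 k).ne'
  generalize θ⁻¹ ^ k = p at h4
  field_simp

end Gamma

/-! ### The base under exponential scaling -/

section Scaling

/-- With ε = e^{-at}, the base is 1 plus the difference quotient of ε ↦ e^{-asε} at 0. -/
lemma tendsto_mgfBase_scaled {a : ℝ} (ha : 0 < a) (s : ℝ) :
    Tendsto (fun t => mgfBase a (s * Real.exp (-(a * t))) t) atTop (𝓝 (1 - a * s)) := by
  have h1 : HasDerivAt (fun ε : ℝ => Real.exp (-(a * s * ε))) (-(a * s)) 0 := by
    have : HasDerivAt (fun ε : ℝ => -(a * s * ε)) (-(a * s)) 0 := by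
      simpa using (hasDerivAt_id (0 : ℝ)).const_mul (-(a * s))
    simpa using this.exp
  have h2 : Tendsto (fun t : ℝ => Real.exp (-(a * t))) atTop (𝓝[≠] 0) := by
    refine tendsto_nhdsWithin_iff.2 ⟨?_, Eventually.of_forall fun t => (Real.exp_pos _).ne'⟩
    exact Real.tendsto_exp_atBot.comp (tendsto_neg_atTop_atBot.comp
      (tendsto_id.const_mul_atTop ha))
  have h3 := (hasDerivAt_iff_tendsto_slope_zero.1 h1).comp h2
  have h4 := h3.const_add 1
  refine (h4.congr fun t => ?_).trans_eq (by ring_nf)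
  simp only [Function.comp_apply, zero_add, mul_zero, neg_zero, Real.exp_zero, smul_eq_mul, mgfBase]
  rw [← Real.exp_neg, neg_neg, mul_assoc a s]
  ring

/-- From 1 + v ≤ e^v. The bound is uniform in time: it makes `s` admissible at every `t` once `a * s
< 1`, and gives the uniform moment bound behind tightness. -/
lemma one_sub_mul_le_mgfBase_scaled (a s t : ℝ) :
    1 - a * s ≤ mgfBase a (s * Real.exp (-(a * t))) t := by
  have h1 := Real.add_one_le_exp (-(a * (s * Real.exp (-(a * t)))))
  have h2 : Real.exp (a * t) * Real.exp (-(a * t)) = 1 := by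
    rw [← Real.exp_add, add_neg_cancel, Real.exp_zero]
  have h3 : Real.exp (a * t) * (1 - Real.exp (-(a * (s * Real.exp (-(a * t)))))) ≤
      Real.exp (a * t) * (a * (s * Real.exp (-(a * t)))) := by
    gcongr; linarith
  have h4 : Real.exp (a * t) * (a * (s * Real.exp (-(a * t)))) = a * s := by
    linear_combination a * s * h2
  rw [mgfBase]
  linarith

end Scaling

lemma jointMgf_single {ι : Type*} [Fintype ι] [DecidableEq ι] (α y : ι → ℝ) (i : ι) (u τ : ℝ) :
    jointMgf α (Pi.single i u) τ y = mgfBase (α i) u τ ^ (-(y i / α i)) := by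
  rw [jointMgf, Finset.prod_eq_single i]
  · simp
  · intro k _ hk
    simp [hk, mgfBase_zero_left]
  · simp

/-! ### Scaled walk: generating functions, tightness and limit law -/

section Driven

variable {Ω : Type*} [MeasurableSpace Ω] {c : ℕ} {P : Measure Ω}
  {α x : Fin c → ℝ} {X : ℝ≥0 → Ω → Fin c → ℝ} {W : ℕ → Ω → ℝ} {I : ℕ → Ω → Fin c}

namespace IsDrivenBy

lemma integrable_exp_and_mgf_eq [IsProbabilityMeasure P]
    (h : IsDrivenBy P (Matrix.diagonal α) x X W I) (hα : ∀ i, 0 < α i) (hx : ∀ i, 0 ≤ x i)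
    (hx₀ : x ≠ 0) (i : Fin c) {t : ℝ≥0} {u : ℝ} (hu : 0 < mgfBase (α i) u t) :
    Integrable (fun ω => Real.exp (u * X t ω i)) P ∧
      mgf (fun ω => X t ω i) P u = mgfBase (α i) u t ^ (-(x i / α i)) := by
  have hu' : ∀ k, 0 < mgfBase (α k) ((Pi.single i u : Fin c → ℝ) k) t := by
    intro k
    by_cases hk : k = i
    · subst hk; simpa using hu
    · simp [hk, mgfBase_zero_left]
  have hsum : ∀ ω, ∑ k, (Pi.single i u : Fin c → ℝ) k * X t ω k = u * X t ω i := fun ω => by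
    rw [Finset.sum_eq_single i] <;> simp +contextual
  have h1 := h.integrable_exp_sum hα hx hx₀ hu'
  have h2 := h.integral_exp_sum hα hx hx₀ hu'
  simp only [hsum, jointMgf_single] at h1 h2
  exact ⟨h1, h2⟩

lemma mgf_scaled [IsProbabilityMeasure P]
    (h : IsDrivenBy P (Matrix.diagonal α) x X W I) (hα : ∀ i, 0 < α i) (hx : ∀ i, 0 ≤ x i)
    (hx₀ : x ≠ 0) (i : Fin c) (t : ℝ≥0) {s : ℝ} (hs : α i * s < 1) :
    Integrable (fun ω => Real.exp (s * (X t ω i / Real.exp (α i * t)))) P ∧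
      mgf (fun ω => X t ω i / Real.exp (α i * t)) P s =
        mgfBase (α i) (s * Real.exp (-(α i * t))) t ^ (-(x i / α i)) := by
  have hpos : 0 < mgfBase (α i) (s * Real.exp (-(α i * t))) t :=
    (sub_pos.2 hs).trans_le (one_sub_mul_le_mgfBase_scaled _ _ _)
  have h1 := h.integrable_exp_and_mgf_eq hα hx hx₀ i hpos
  have h2 : ∀ ω, s * Real.exp (-(α i * t)) * X t ω i = s * (X t ω i / Real.exp (α i * t)) :=
    fun ω => by rw [Real.exp_neg]; ring
  simpa only [mgf, h2] using h1

lemma tendsto_mgf_scaled [IsProbabilityMeasure P]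
    (h : IsDrivenBy P (Matrix.diagonal α) x X W I) (hα : ∀ i, 0 < α i) (hx : ∀ i, 0 ≤ x i)
    (hx₀ : x ≠ 0) (i : Fin c) {s : ℝ} (hs : α i * s < 1) :
    Tendsto (fun t : ℝ≥0 => mgf (fun ω => X t ω i / Real.exp (α i * t)) P s) atTop
      (𝓝 ((1 - α i * s) ^ (-(x i / α i)))) := by
  simp_rw [fun t => (h.mgf_scaled hα hx hx₀ i t hs).2]
  exact ((tendsto_mgfBase_scaled (hα i) s).comp
    (NNReal.tendsto_coe_atTop.2 tendsto_id)).rpow_const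
    (Or.inl (sub_pos.2 hs).ne')

lemma ae_nonneg [IsProbabilityMeasure P]
    (h : IsDrivenBy P (Matrix.diagonal α) x X W I) (hα : ∀ i, 0 < α i) (hx : ∀ i, 0 ≤ x i)
    (hx₀ : x ≠ 0) (t : ℝ≥0) : ∀ᵐ ω ∂P, ∀ i, 0 ≤ X t ω i := by
  filter_upwards [h.ae_exists_eq_polyaPosition hα hx hx₀ t] with ω ⟨n, hn⟩ i
  rw [hn]
  exact (hx i).trans (polyaPosition_ge hα n ω i)

lemma aemeasurable_scaled [IsProbabilityMeasure P]
    (h : IsDrivenBy P (Matrix.diagonal α) x X W I) (hα : ∀ i, 0 < α i) (hx : ∀ i, 0 ≤ x i)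
    (hx₀ : x ≠ 0) (t : ℝ≥0) :
    AEMeasurable (fun ω i => X t ω i / Real.exp (α i * t)) P :=
  aemeasurable_pi_lambda _ fun i =>
    (aemeasurable_pi_iff.1 (h.aemeasurable hα hx hx₀ t) i).div_const _

/-- Chernoff's bound at half the critical argument `1 / α i`, where the base stays at least 1/2 for
all times. -/
lemma measure_scaled_ge_le [IsProbabilityMeasure P]
    (h : IsDrivenBy P (Matrix.diagonal α) x X W I) (hα : ∀ i, 0 < α i) (hx : ∀ i, 0 ≤ x i)
    (hx₀ : x ≠ 0) (i : Fin c) (t : ℝ≥0) (R : ℝ) :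
    P {ω | R ≤ X t ω i / Real.exp (α i * t)} ≤
      ENNReal.ofReal (Real.exp (-(2 * α i)⁻¹ * R) * 2⁻¹ ^ (-(x i / α i))) := by
  have hαi := hα i
  have hs : α i * (2 * α i)⁻¹ = 2⁻¹ := by field_simp
  obtain ⟨h1, h2⟩ := h.mgf_scaled hα hx hx₀ i t (s := (2 * α i)⁻¹) (by rw [hs]; norm_num)
  have h3 := measure_ge_le_exp_mul_mgf (X := fun ω => X t ω i / Real.exp (α i * t)) R
    (by positivity) h1
  rw [← ofReal_measureReal]
  refine ENNReal.ofReal_le_ofReal (h3.trans ?_)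
  rw [h2]
  refine mul_le_mul_of_nonneg_left ?_ (Real.exp_pos _).le
  refine Real.rpow_le_rpow_of_nonpos (by norm_num) ?_
    (neg_nonpos.2 (div_nonneg (hx i) hαi.le))
  have := one_sub_mul_le_mgfBase_scaled (α i) (2 * α i)⁻¹ t
  rw [hs] at this
  linarith

/-- A union bound over coordinates puts all but `ε` of the mass in one box for all times;
`measure_scaled_ge_le` does not depend on `t`. -/
lemma isTight_scaled [IsProbabilityMeasure P]
    (h : IsDrivenBy P (Matrix.diagonal α) x X W I) (hα : ∀ i, 0 < α i) (hx : ∀ i, 0 ≤ x i)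
    (hx₀ : x ≠ 0) :
    IsTightMeasureSet (Set.range fun t : ℝ≥0 =>
      P.map fun ω i => (X t ω i / Real.exp (α i * t)).toNNReal) := by
  rw [isTightMeasureSet_iff_exists_isCompact_measure_compl_le]
  intro ε hε
  have hlim : Tendsto (fun R : ℝ≥0 => ∑ i,
      ENNReal.ofReal (Real.exp (-(2 * α i)⁻¹ * R) * 2⁻¹ ^ (-(x i / α i)))) atTop (𝓝 0) := by
    have h1 : ∀ i, Tendsto (fun R : ℝ≥0 =>
        ENNReal.ofReal (Real.exp (-(2 * α i)⁻¹ * R) * 2⁻¹ ^ (-(x i / α i)))) atTop (𝓝 0) := by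
      intro i
      have hneg : -(2 * α i)⁻¹ < 0 := by
        have := hα i
        exact neg_lt_zero.2 (by positivity)
      have h2 : Tendsto (fun R : ℝ≥0 => Real.exp (-(2 * α i)⁻¹ * R)) atTop (𝓝 0) :=
        Real.tendsto_exp_atBot.comp
          ((NNReal.tendsto_coe_atTop.2 tendsto_id).const_mul_atTop_of_neg hneg)
      simpa using ENNReal.tendsto_ofReal (h2.mul_const (2⁻¹ ^ (-(x i / α i))))
    simpa using tendsto_finsetSum Finset.univ fun i _ => h1 i
  obtain ⟨R, hR⟩ := (hlim.eventually (ge_mem_nhds hε)).exists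
  refine ⟨Set.Icc 0 fun _ => R, isCompact_Icc, ?_⟩
  rintro _ ⟨t, rfl⟩
  have hm : AEMeasurable (fun ω i => (X t ω i / Real.exp (α i * t)).toNNReal) P :=
    aemeasurable_pi_lambda _ fun i =>
      (aemeasurable_pi_iff.1 (h.aemeasurable_scaled hα hx hx₀ t) i).real_toNNReal
  rw [Measure.map_apply_of_aemeasurable hm measurableSet_Icc.compl]
  refine le_trans (measure_mono fun ω hω => ?_) ((measure_iUnion_fintype_le P fun i =>
    {ω | (R : ℝ) ≤ X t ω i / Real.exp (α i * t)}).trans ((Finset.sum_le_sum fun i _ =>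
      h.measure_scaled_ge_le hα hx hx₀ i t R).trans hR))
  by_contra hcon
  simp only [Set.mem_iUnion, not_exists] at hcon
  refine hω ⟨fun i => zero_le, fun i => ?_⟩
  exact Real.toNNReal_le_iff_le_coe.2 (not_le.1 (hcon i)).le

lemma tendsto_integral_exp_neg_scaled [IsProbabilityMeasure P]
    (h : IsDrivenBy P (Matrix.diagonal α) x X W I) (hα : ∀ i, 0 < α i) (hx : ∀ i, 0 ≤ x i)
    (hx₀ : x ≠ 0) {s : Fin c → ℝ} (hs : ∀ i, 0 ≤ s i) :
    Tendsto (fun t : ℝ≥0 => ∫ ω, Real.exp (-∑ i, s i * (X t ω i / Real.exp (α i * t))) ∂P) atTop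
      (𝓝 (∏ i, (1 + α i * s i) ^ (-(x i / α i)))) := by
  have h1 : ∀ t : ℝ≥0, ∫ ω, Real.exp (-∑ i, s i * (X t ω i / Real.exp (α i * t))) ∂P =
      ∏ i, mgfBase (α i) (-s i * Real.exp (-(α i * t))) t ^ (-(x i / α i)) := by
    intro t
    refine Eq.trans ?_ (h.integral_exp_sum hα hx hx₀ (t := t)
      (u := fun i => -s i * Real.exp (-(α i * t))) fun i => mgfBase_pos_of_nonpos (hα i) ?_)
    · refine integral_congr_ae (ae_of_all _ fun ω => ?_)
      simp only [← Finset.sum_neg_distrib, Real.exp_neg]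
      congr 1
      exact Finset.sum_congr rfl fun i _ => by ring
    · exact mul_nonpos_of_nonpos_of_nonneg (neg_nonpos.2 (hs i)) (Real.exp_pos _).le
  simp_rw [h1]
  refine tendsto_finsetProd _ fun i _ => ?_
  have h2 := (tendsto_mgfBase_scaled (hα i) (-s i)).comp (NNReal.tendsto_coe_atTop.2 tendsto_id)
  have h3 : 0 < 1 + α i * s i := by linarith [mul_nonneg (hα i).le (hs i)]
  rw [mul_neg, sub_neg_eq_add] at h2
  exact h2.rpow_const (Or.inl h3.ne')

/-- The scaled walk converges in distribution to a vector of independent gamma variables. -/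
lemma tendstoInDistribution_scaled [IsProbabilityMeasure P]
    (h : IsDrivenBy P (Matrix.diagonal α) x X W I) (hα : ∀ i, 0 < α i) (hx : ∀ i, 0 ≤ x i)
    (hx₀ : x ≠ 0) :
    TendstoInDistribution (fun (t : ℝ≥0) ω (i : Fin c) => X t ω i / Real.exp (α i * t)) atTop
      (id : (Fin c → ℝ) → (Fin c → ℝ)) (fun _ => P)
      (Measure.pi fun i => gammaLaw (x i / α i) (α i)) := by
  have hm : ∀ t : ℝ≥0, AEMeasurable (fun ω i => (X t ω i / Real.exp (α i * t)).toNNReal) P :=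
    fun t => aemeasurable_pi_lambda _ fun i =>
      (aemeasurable_pi_iff.1 (h.aemeasurable_scaled hα hx hx₀ t) i).real_toNNReal
  have hm₀ : Measurable fun (y : Fin c → ℝ) i => (y i).toNNReal := by fun_prop
  have hnn : ∀ᵐ y ∂Measure.pi fun i => gammaLaw (x i / α i) (α i), ∀ i, 0 ≤ y i := by
    refine ae_all_iff.2 fun i => ?_
    exact (measurePreserving_eval (fun i => gammaLaw (x i / α i) (α i)) i).quasiMeasurePreserving.ae
      (ae_nonneg_gammaLaw _ _)
  have hexp : ∀ s : Fin c → ℝ≥0, Measurable fun y : Fin c → ℝ≥0 =>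
      Real.exp (-∑ i, (s i : ℝ) * y i) := fun s => (by fun_prop : Continuous _).measurable
  -- The argument runs on the nonnegative orthant, where the functions exp(-s·y) with s ≥ 0 are
  -- bounded. Both the walk and the limit are almost surely nonnegative, so truncation by `toNNReal`
  -- loses nothing.
  have key : TendstoInDistribution
      (fun (t : ℝ≥0) ω (i : Fin c) => (X t ω i / Real.exp (α i * t)).toNNReal) atTop
      (fun (y : Fin c → ℝ) i => (y i).toNNReal) (fun _ => P)
      (Measure.pi fun i => gammaLaw (x i / α i) (α i)) := by
    refine ⟨hm, hm₀.aemeasurable, tendsto_of_tendsto_laplace (h.isTight_scaled hα hx hx₀)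
      fun s => ?_⟩
    simp only [ProbabilityMeasure.coe_mk]
    rw [integral_map hm₀.aemeasurable (hexp s).aestronglyMeasurable]
    simp_rw [fun t => integral_map (hm t) (hexp s).aestronglyMeasurable]
    have h1 : ∫ y : Fin c → ℝ, Real.exp (-∑ i, (s i : ℝ) * (y i).toNNReal)
        ∂Measure.pi (fun i => gammaLaw (x i / α i) (α i)) =
        ∏ i, (1 + α i * s i) ^ (-(x i / α i)) := by
      have h2 : (fun y : Fin c → ℝ => Real.exp (-∑ i, (s i : ℝ) * (y i).toNNReal))
          =ᵐ[Measure.pi fun i => gammaLaw (x i / α i) (α i)]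
          fun y => ∏ i, Real.exp (-(s i * y i)) := by
        filter_upwards [hnn] with y hy
        rw [← Real.exp_sum, Finset.sum_neg_distrib]
        simp_rw [fun i => Real.coe_toNNReal _ (hy i)]
      rw [integral_congr_ae h2,
        integral_fintype_prod_eq_prod (fun i (y : ℝ) => Real.exp (-(s i * y)))]
      exact Finset.prod_congr rfl fun i _ => integral_exp_neg_mul_gammaLaw
        (div_nonneg (hx i) (hα i).le) (hα i) (s i).2
    rw [h1]
    refine (h.tendsto_integral_exp_neg_scaled hα hx hx₀ fun i => (s i).2).congr fun t => ?_
    refine integral_congr_ae ?_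
    filter_upwards [h.ae_nonneg hα hx hx₀ t] with ω hω
    simp_rw [fun i => Real.coe_toNNReal _ (div_nonneg (hω i) (Real.exp_pos (α i * t)).le)]
    rfl
  -- The continuous inclusion of the orthant carries the limit back to real vectors.
  refine (key.continuous_comp (g := fun (y : Fin c → ℝ≥0) i => (y i : ℝ)) (by fun_prop)).congr
    (fun t => ?_) ?_
  · filter_upwards [h.ae_nonneg hα hx hx₀ t] with ω hω
    ext i
    exact Real.coe_toNNReal _ (div_nonneg (hω i) (Real.exp_pos (α i * t)).le)
  · filter_upwards [hnn] with y hy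
    ext i
    exact Real.coe_toNNReal _ (hy i)

end IsDrivenBy

end Driven

/-! ### Marginals and conclusion -/

lemma tendstoInDistribution_eval_of_pi {Ω ι κ : Type*} [MeasurableSpace Ω] {P : Measure Ω}
    [IsProbabilityMeasure P] [Fintype ι] {l : Filter κ} {Y : κ → Ω → ι → ℝ} {ν : ι → Measure ℝ}
    [∀ i, IsProbabilityMeasure (ν i)]
    (h : TendstoInDistribution Y l (id : (ι → ℝ) → ι → ℝ) (fun _ => P) (Measure.pi ν)) (i : ι) :
    TendstoInDistribution (fun t ω => Y t ω i) l (id : ℝ → ℝ) (fun _ => P) (ν i) := by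
  have h1 := h.continuous_comp (continuous_apply i)
  refine ⟨h1.forall_aemeasurable, aemeasurable_id, ?_⟩
  convert! h1.tendsto using 2
  refine congrArg 𝓝 (Subtype.ext ?_)
  change (ν i).map id = (Measure.pi ν).map (Function.eval i)
  rw [Measure.map_id, (measurePreserving_eval ν i).map_eq]

theorem mainTheorem6 {Ω : Type*} [MeasurableSpace Ω] (P : Measure Ω) [IsProbabilityMeasure P]
    {c : ℕ} (α x : Fin c → ℝ) (hα : ∀ i, 0 < α i) (hx : ∀ i, 0 ≤ x i) (hx₀ : x ≠ 0)
    (X : ℝ≥0 → Ω → Fin c → ℝ)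
    (hX : IsContinuumPolyaWalk P (Matrix.diagonal α) x X) :
    -- the moment generating function of each coordinate, wherever the base is positive
    (∀ (i : Fin c) (t : ℝ≥0) (u : ℝ),
      0 < 1 - Real.exp (α i * t) * (1 - Real.exp (-(α i * u))) →
        Integrable (fun ω => Real.exp (u * X t ω i)) P ∧
        mgf (fun ω => X t ω i) P u =
          (1 - Real.exp (α i * t) * (1 - Real.exp (-(α i * u)))) ^ (-(x i / α i))) ∧
    -- the limit of the moment generating function of the scaled coordinate
    (∀ (i : Fin c) (s : ℝ), α i * s < 1 →
      Tendsto (fun t : ℝ≥0 => mgf (fun ω => X t ω i / Real.exp (α i * t)) P s) atTop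
        (𝓝 ((1 - α i * s) ^ (-(x i / α i))))) ∧
    -- convergence in distribution of each scaled coordinate
    (∀ i : Fin c,
      TendstoInDistribution (fun (t : ℝ≥0) ω => X t ω i / Real.exp (α i * t)) atTop
        (id : ℝ → ℝ) (fun _ => P) (gammaLaw (x i / α i) (α i))) ∧
    -- joint convergence in distribution, to a vector with independent coordinates
    TendstoInDistribution (fun (t : ℝ≥0) ω (i : Fin c) => X t ω i / Real.exp (α i * t)) atTop
      (id : (Fin c → ℝ) → (Fin c → ℝ)) (fun _ => P)
      (Measure.pi fun i => gammaLaw (x i / α i) (α i)) := by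
  obtain ⟨W, I, h⟩ := hX
  have h4 := h.tendstoInDistribution_scaled hα hx hx₀
  exact ⟨fun i t u hu => h.integrable_exp_and_mgf_eq hα hx hx₀ i hu,
    fun i s hs => h.tendsto_mgf_scaled hα hx hx₀ i hs,
    fun i => tendstoInDistribution_eval_of_pi h4 i, h4⟩
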